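/- **Setting.** Let $\lambda\ge\sigma>0$ and let $\mathcal D_{\mathrm{sG}}(\lambda,\sigma)$ be the family of all probability distributions $D$ on $\mathbb R$ with mean $\mu(D)\in[-\lambda,\lambda]$ such that, for $X\sim D$, $X-\mu(D)$ is sub-Gaussian with parameter $\sigma^2$, i.e. $\mathbb E\,e^{t(X-\mu(D))}\le e^{\sigma^2t^2/2}$ for all $t\in\mathbb R$. A *1-bit mean estimator with $n$ samples* operates in rounds $t=1,\dots,n$: it chooses a (measurable) function $Q_t:\mathbb R\to\{0,1\}$, possibly at random and depending on the history $(Q_1,Y_1,\dots,Q_{t-1},Y_{t-1})$, and receives only the bit $Y_t=Q_t(X_t)$, where $X_1,X_2,\dots$ are i.i.d. with law $D$ and independent of the internal randomness. After $n$ rounds it outputs an estimate $\hat\mu\in\mathbb R$ that is a function of the transcript $(Q_1,Y_1,\dots,Q_n,Y_n)$. It is *$(\epsilon,\delta)$-PAC* for a family $\mathcal D$ if $\Pr(|\hat\mu-\mu(D)|\le\epsilon)\ge 1-\delta$ for every $D\in\mathcal D$, the probability being over the samples and the internal randomness. **Corollary.** For every $\delta_0\in(0,1)$ there is a constant $C>0$,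 depending only on $\delta_0$ (so an absolute constant once, say, $\delta_0=1/2$ is fixed), such that for all $\lambda\ge\sigma>0$, all $\epsilon>0$ and all $\delta\in(0,\delta_0]$ there exists a 1-bit mean estimator (which may depend on $\lambda,\sigma,\epsilon,\delta$) that is $(\epsilon,\delta)$-PAC for $\mathcal D_{\mathrm{sG}}(\lambda,\sigma)$ and uses $$n\le C\left(\frac{\sigma^2}{\epsilon^2}\log\frac1\delta+\log\frac{\lambda}{\sigma}\right)$$ samples. -/

import Mathlib

open MeasureTheory ProbabilityTheory

/-- A 1-bit quantization function `Q : ℝ → {0, 1}`. -/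
abbrev Query : Type := ℝ → Bool

/-- An interaction history `(Q₁, Y₁, …, Qₜ, Yₜ)`, in chronological order. -/
abbrev Transcript : Type := List (Query × Bool)

/-- The history after `t` rounds, when the internal randomness of the learner is `s` and the
samples are `x 0, x 1, …`: in each round the next query is chosen from the internal randomness and
the current history alone, it is applied to a fresh sample, and the query together with the
1-bit answer is appended. The first `t` rounds only use the samples `x 0, …, x (t - 1)`. -/
def transcript {S : Type} (strategy : S → Transcript → Query) (s : S) (x : ℕ → ℝ) :
    ℕ → Transcript
  | 0 => []
  | t + 1 =>
    transcript strategy s x t ++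
      [(strategy s (transcript strategy s x t),
        strategy s (transcript strategy s x t) (x t))]

/-- A 1-bit mean estimator that uses `n` samples: an adaptive, possibly randomized query strategy
(its internal randomness is a seed `s` drawn from `seedLaw`, independently of the samples),
and an estimation rule that maps the full transcript of the `n` rounds to a real number.
Queries, answers and the final estimate are required to be measurable. -/
structure OneBitMeanEstimator (n : ℕ) where
  Seed : Type
  [seedMeasurableSpace : MeasurableSpace Seed]
  seedLaw : Measure Seed
  [seedLaw_isProbabilityMeasure : IsProbabilityMeasure seedLaw]
  strategy : Seed → Transcript → Query
  estimate : Transcript → ℝ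
  measurable_query : ∀ (s : Seed) (h : Transcript), Measurable (strategy s h)
  measurable_answer : ∀ t < n, Measurable fun p : Seed × (ℕ → ℝ) =>
    strategy p.1 (transcript strategy p.1 p.2 t) (p.2 t)
  measurable_estimate : Measurable fun p : Seed × (ℕ → ℝ) =>
    estimate (transcript strategy p.1 p.2 n)

attribute [instance] OneBitMeanEstimator.seedMeasurableSpace
  OneBitMeanEstimator.seedLaw_isProbabilityMeasure

/-- The estimate returned after `n` rounds, as a function of the seed and the samples. -/
def OneBitMeanEstimator.output {n : ℕ} (A : OneBitMeanEstimator n) (s : A.Seed) (x : ℕ → ℝ) : ℝ :=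
  A.estimate (transcript A.strategy s x n)

/-- `(ε, δ)`-PAC for a family of distributions: for each `D` in the family, with i.i.d. samples
from `D`, the estimate is within `ε` of the mean of `D` with probability at least `1 - δ` over the
samples and the internal randomness. -/
def OneBitMeanEstimator.IsPAC {n : ℕ} (A : OneBitMeanEstimator n) (ε δ : ℝ)
    (family : Set (ProbabilityMeasure ℝ)) : Prop :=
  ∀ D ∈ family,
    1 - δ ≤ (A.seedLaw.prod (Measure.infinitePi fun _ : ℕ => (D : Measure ℝ))).real
      {p | |A.output p.1 p.2 - ∫ y, y ∂(D : Measure ℝ)| ≤ ε}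

/-- The distributions on `ℝ` with mean `μ ∈ [-lam, lam]` such that `X - μ` is sub-Gaussian with
parameter `σ²`, that is `𝔼[exp (t (X - μ))] ≤ exp (σ² t² / 2)` for all real `t`. -/
def subGaussianFamily (lam σ : ℝ) : Set (ProbabilityMeasure ℝ) :=
  {D | (∫ y, y ∂(D : Measure ℝ)) ∈ Set.Icc (-lam) lam ∧
    HasSubgaussianMGF (fun x : ℝ => x - ∫ y, y ∂(D : Measure ℝ)) (Real.toNNReal (σ ^ 2))
      (D : Measure ℝ)}

/-! The estimator is deterministic and combines a noisy search, which locates the mean coarsely,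
with non-adaptive threshold queries around the location found.

The search walks on a binary tree of overlapping intervals and may step back to the parent. If the
two samples of a step lie within `r` of the mean, the potential (containing minus non-containing
nodes on the path) rises by one; otherwise it drops by at most one (`pathPotential_step_of_close`,
`le_pathPotential_searchState`). Far samples are so rare that fewer than `K / 4` of `2K` are far,
except with probability `exp (-K r² / (32 σ²))` (`measureReal_card_far_le`). The final potential
then forces most nodes of the path to lie near the mean, and a majority vote recovers it up to `9r`
(`abs_pathDecode_sub_le`). For errors `ε` between `144σ` and `lam` this alone suffices, with `r = ε
/ 9`.

For smaller `ε` the search runs at `r = 16σ`, giving a centre `c` within `144σ`. With `V = (y - c) /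
σ`, the mean of `V` is `𝔼 V⁺ - 𝔼 V⁻`, and each term is an integral of tail probabilities,
approximated by a Riemann sum with one sample per threshold. Spacing proportional to `(1 + t)² / M`
reaches height `M` with only `M` thresholds, while the Gaussian tail outweighs the growing weights:
both the bias and the variance are `O(1 / M)` (`abs_integral_max_sub_sum_levelGap_le`,
`measureReal_lt_abs_sum_levelGap_sub_le`). No logarithmic factor is lost.

The centre is random, but it is a multiple of `σ`, so when the search succeeds only 289 values are
possible. A union bound over them replaces conditioning on the search. For `ε ≥ lam` the constant
estimate `0` needs no samples. -/

/-! ### Deterministic estimators driven by bit strings -/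

/-- The bits received in the first `t` rounds by the deterministic learner that chooses its next
query as a function `Q` of the bits received so far. -/
def bits (Q : List Bool → Query) (x : ℕ → ℝ) : ℕ → List Bool
  | 0 => []
  | t + 1 => bits Q x t ++ [Q (bits Q x t) (x t)]

@[simp] theorem length_bits (Q : List Bool → Query) (x : ℕ → ℝ) (t : ℕ) :
    (bits Q x t).length = t := by
  induction t with
  | zero => rfl
  | succ t ih => simp [bits, ih]

theorem take_bits (Q : List Bool → Query) (x : ℕ → ℝ) {m n : ℕ} (h : m ≤ n) :
    (bits Q x n).take m = bits Q x m := by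
  induction n, h using Nat.le_induction with
  | base => simp [List.take_of_length_le]
  | succ n hmn ih =>
    rw [bits, List.take_append_of_le_length (by simpa using hmn), ih]

theorem getD_bits (Q : List Bool → Query) (x : ℕ → ℝ) {i n : ℕ} (h : i < n) :
    (bits Q x n).getD i false = Q (bits Q x i) (x i) := by
  induction n, h using Nat.le_induction with
  | base => simp [bits, List.getD]
  | succ n hmn ih =>
    rw [← ih, bits, List.getD_append _ _ _ _ (by simpa using hmn)]

theorem measurable_bits {Q : List Bool → Query} (hQ : ∀ l, Measurable (Q l)) (t : ℕ) :
    Measurable[_, ⊤] fun x : ℕ → ℝ => bits Q x t := by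
  let _ : MeasurableSpace (List Bool) := ⊤
  have : DiscreteMeasurableSpace (List Bool) := ⟨fun _ => trivial⟩
  induction t with
  | zero => exact measurable_const
  | succ t ih =>
    have h : Measurable fun q : List Bool × ℝ => q.1 ++ [Q q.1 q.2] :=
      measurable_from_prod_countable_right fun l =>
        (measurable_of_countable fun b : Bool => l ++ [b]).comp (hQ l)
    exact h.comp (ih.prodMk (measurable_pi_apply t))

theorem map_snd_transcript (Q : List Bool → Query) (s : Unit) (x : ℕ → ℝ) (t : ℕ) :
    (transcript (fun (_ : Unit) h => Q (h.map Prod.snd)) s x t).map Prod.snd = bits Q x t := by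
  induction t with
  | zero => rfl
  | succ t ih => simp [transcript, bits, ih]

/-- The estimator without internal randomness that is given by a query rule and an estimation rule
on bit strings. -/
noncomputable def detEstimator (Q : List Bool → Query) (hQ : ∀ l, Measurable (Q l))
    (E : List Bool → ℝ) (n : ℕ) : OneBitMeanEstimator n where
  Seed := Unit
  seedLaw := Measure.dirac ()
  strategy := fun _ h => Q (h.map Prod.snd)
  estimate := fun h => E (h.map Prod.snd)
  measurable_query := fun _ _ => hQ _
  measurable_answer := fun t _ => by
    let _ : MeasurableSpace (List Bool) := ⊤
    have : DiscreteMeasurableSpace (List Bool) := ⟨fun _ => trivial⟩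
    simp only [map_snd_transcript]
    have h : Measurable fun q : List Bool × ℝ => Q q.1 q.2 :=
      measurable_from_prod_countable_right fun l => hQ l
    exact h.comp (((measurable_bits hQ t).comp measurable_snd).prodMk
      ((measurable_pi_apply t).comp measurable_snd))
  measurable_estimate := by
    let _ : MeasurableSpace (List Bool) := ⊤
    have : DiscreteMeasurableSpace (List Bool) := ⟨fun _ => trivial⟩
    simp only [map_snd_transcript]
    exact (measurable_of_countable E).comp ((measurable_bits hQ n).comp measurable_snd)

/-- Only subadditivity of the outer measure is used, so exceptional sets may be given without any
proof of measurability. -/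
theorem isPAC_detEstimator {Q : List Bool → Query} (hQ : ∀ l, Measurable (Q l))
    {E : List Bool → ℝ} {n : ℕ} {ε δ : ℝ} {family : Set (ProbabilityMeasure ℝ)}
    (h : ∀ D ∈ family, ∃ bad : Set (ℕ → ℝ),
      (Measure.infinitePi fun _ : ℕ => (D : Measure ℝ)).real bad ≤ δ ∧
      ∀ x ∉ bad, |E (bits Q x n) - ∫ y, y ∂(D : Measure ℝ)| ≤ ε) :
    (detEstimator Q hQ E n).IsPAC ε δ family := by
  intro D hD
  obtain ⟨bad, hbad, hgood⟩ := h D hD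
  set P := Measure.infinitePi fun _ : ℕ => (D : Measure ℝ)
  set G : Set (ℕ → ℝ) := {x | |E (bits Q x n) - ∫ y, y ∂(D : Measure ℝ)| ≤ ε}
  have h1 : (1 : ℝ) ≤ P.real G + P.real bad := by
    rw [← probReal_univ (μ := P)]
    refine (measureReal_mono (fun x _ => ?_) (by simp)).trans (measureReal_union_le G bad)
    by_cases hx : x ∈ bad
    · exact Or.inr hx
    · exact Or.inl (hgood x hx)
  have h2 : P.real G ≤ ((detEstimator Q hQ E n).seedLaw.prod P).real
      {p | |(detEstimator Q hQ E n).output p.1 p.2 - ∫ y, y ∂(D : Measure ℝ)| ≤ ε} := by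
    have h3 : (detEstimator Q hQ E n).seedLaw.prod P = P.map (Prod.mk ()) :=
      Measure.dirac_prod ()
    rw [h3]
    refine ENNReal.toReal_mono (measure_ne_top _ _) (le_trans (measure_mono fun x hx => ?_)
      (Measure.le_map_apply measurable_prodMk_left.aemeasurable _))
    have h4 : (detEstimator Q hQ E n).output () x = E (bits Q x n) :=
      congrArg E (map_snd_transcript Q () x n)
    have h5 : |E (bits Q x n) - ∫ y, y ∂(D : Measure ℝ)| ≤ ε := hx
    rw [← h4] at h5
    exact h5
  linarith

/-! ### A Chernoff bound for weighted indicators -/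

/-- The integral equals `1 + p (exp a - 1)`, and `1 + z ≤ exp z`. Keeping the factor `p` makes large
weights affordable on rare events. -/
theorem integral_exp_mul_indicator_le (D : Measure ℝ) [IsProbabilityMeasure D] {S : Set ℝ}
    (hS : MeasurableSet S) (a : ℝ) :
    ∫ y, Real.exp (a * S.indicator 1 y) ∂D ≤ Real.exp (D.real S * (Real.exp a - 1)) := by
  have h : (fun y => Real.exp (a * S.indicator 1 y)) =
      fun y => 1 + S.indicator (fun _ => Real.exp a - 1) y := by
    ext y
    by_cases hy : y ∈ S <;> simp [hy]
  have hi : Integrable (S.indicator fun _ => Real.exp a - 1) D :=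
    (integrable_const _).indicator hS
  rw [h, integral_add (integrable_const _) hi, integral_indicator_const _ hS]
  simp only [integral_const, probReal_univ, smul_eq_mul, one_mul]
  linarith [Real.add_one_le_exp (D.real S * (Real.exp a - 1))]

/-- Chernoff's bound for a weighted number of successes in independent trials. -/
theorem chernoff_infinitePi (D : Measure ℝ) [IsProbabilityMeasure D] (J : Finset ℕ)
    {S : ℕ → Set ℝ} (hS : ∀ j, MeasurableSet (S j)) (a : ℕ → ℝ) (b : ℝ) :
    (Measure.infinitePi fun _ : ℕ => D).real
        {x | b ≤ ∑ j ∈ J, a j * (S j).indicator 1 (x j)} ≤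
      Real.exp (∑ j ∈ J, D.real (S j) * (Real.exp (a j) - 1) - b) := by
  set P := Measure.infinitePi fun _ : ℕ => D
  let X : ℕ → (ℕ → ℝ) → ℝ := fun j x => a j * (S j).indicator 1 (x j)
  have hf : ∀ j, Measurable fun y : ℝ => a j * (S j).indicator (1 : ℝ → ℝ) y := fun j =>
    (measurable_one.indicator (hS j)).const_mul _
  have hX : ∀ j, Measurable (X j) := fun j => (hf j).comp (measurable_pi_apply j)
  have hind : iIndepFun X P :=
    iIndepFun_infinitePi (P := fun _ : ℕ => D) (X := fun j y => a j * (S j).indicator 1 y) hf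
  have hbound : ∀ j x, |X j x| ≤ |a j| := fun j x => by
    by_cases hy : x j ∈ S j <;> simp [X, hy]
  have hint : Integrable (fun x => Real.exp (1 * (∑ j ∈ J, X j) x)) P := by
    refine Integrable.of_bound (C := Real.exp (∑ j ∈ J, |a j|)) ?_ (.of_forall fun x => ?_)
    · refine Measurable.aestronglyMeasurable ?_
      simp only [Finset.sum_apply]
      exact Real.measurable_exp.comp
        ((Finset.measurable_sum J fun j _ => hX j).const_mul 1)
    · rw [Real.norm_eq_abs, Real.abs_exp, one_mul, Finset.sum_apply]
      exact Real.exp_le_exp.2 (Finset.sum_le_sum fun j _ => (le_abs_self _).trans (hbound j x))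
  -- The exponential parameter is `1`, since the weights `a j` already carry the scale.
  have h1 := measure_ge_le_exp_mul_mgf (μ := P) (X := ∑ j ∈ J, X j) b zero_le_one hint
  rw [hind.mgf_sum hX] at h1
  have h2 : ∏ j ∈ J, mgf (X j) P 1 ≤ Real.exp (∑ j ∈ J, D.real (S j) * (Real.exp (a j) - 1)) := by
    rw [Real.exp_sum]
    refine Finset.prod_le_prod (fun j _ => mgf_nonneg) fun j _ => ?_
    have h3 : mgf (X j) P 1 = ∫ y, Real.exp (a j * (S j).indicator 1 y) ∂D := by
      have h4 : P.map (fun x => x j) = D := Measure.infinitePi_map_eval (fun _ : ℕ => D) j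
      conv_rhs => rw [← h4]
      rw [integral_map (measurable_pi_apply j).aemeasurable
        (Real.measurable_exp.comp (hf j)).aestronglyMeasurable]
      simp [mgf, X]
    rw [h3]
    exact integral_exp_mul_indicator_le D (hS j) (a j)
  have h5 : {x | b ≤ ∑ j ∈ J, a j * (S j).indicator 1 (x j)} = {x | b ≤ (∑ j ∈ J, X j) x} := by
    simp [X, Finset.sum_apply]
  rw [h5]
  refine h1.trans ?_
  rw [sub_eq_neg_add, Real.exp_add, neg_one_mul]
  gcongr

/-! ### Noisy binary search with backtracking: the potential argument -/

/-- The centre of the interval at the end of a search path. A path lists the centres of the visited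
nodes, latest first; the root, which is not listed, is centred at `0`. -/
def pathCenter (p : List ℝ) : ℝ := p.headD 0

/-- The radius of the intervals at depth `d`. -/
noncomputable def pathRadius (r lam : ℝ) (d : ℕ) : ℝ := 3 * r + lam / 2 ^ d

theorem pathRadius_succ (r lam : ℝ) (d : ℕ) :
    pathRadius r lam (d + 1) = (pathRadius r lam d + 3 * r) / 2 := by
  unfold pathRadius
  field_simp
  ring

/-- One step of the noisy search: go back to the parent node if `outside` is reported, and otherwise
move on to the right or left child. -/
noncomputable def pathStep (r lam : ℝ) (p : List ℝ) (outside right : Bool) : List ℝ :=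
  if outside then p.tail else
    (pathCenter p + if right then (pathRadius r lam p.length + r) / 2
      else -((pathRadius r lam p.length + r) / 2)) :: p

open Classical in
/-- The number of nodes on a path whose interval contains `m`, minus the number of the others. -/
noncomputable def pathPotential (r lam m : ℝ) : List ℝ → ℤ
  | [] => 0
  | c :: p => pathPotential r lam m p +
      if |m - c| ≤ pathRadius r lam (p.length + 1) then 1 else -1

theorem pathPotential_tail_ge (r lam m : ℝ) (p : List ℝ) :
    pathPotential r lam m p - 1 ≤ pathPotential r lam m p.tail := by
  cases p with
  | nil => simp [pathPotential]
  | cons c p =>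
    simp only [pathPotential, List.tail_cons]
    split_ifs <;> omega

theorem pathPotential_step_ge (r lam m : ℝ) (p : List ℝ) (b₁ b₂ : Bool) :
    pathPotential r lam m p - 1 ≤ pathPotential r lam m (pathStep r lam p b₁ b₂) := by
  unfold pathStep
  split_ifs <;> first
    | exact pathPotential_tail_ge r lam m p
    | (simp only [pathPotential]; split_ifs <;> omega)

/-- If the two samples that answer the two queries of a step are `r`-close to `m`, then the step
increases the potential. -/
theorem pathPotential_step_of_close {r lam m : ℝ} (hr : 0 ≤ r) (hm : |m| ≤ lam) (p : List ℝ)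
    {x y : ℝ} (hx : |x - m| ≤ r) (hy : |y - m| ≤ r) :
    pathPotential r lam m p + 1 ≤ pathPotential r lam m
      (pathStep r lam p (decide (pathRadius r lam p.length + r < |x - pathCenter p|))
        (decide (pathCenter p < y))) := by
  rw [abs_le] at hx hy
  unfold pathStep
  by_cases h : pathRadius r lam p.length + r < |x - pathCenter p|
  · have hne : ¬ |m - pathCenter p| ≤ pathRadius r lam p.length := fun h' => by
      rw [abs_le] at h'
      rw [lt_abs] at h
      rcases h with h | h <;> linarith
    cases p with
    | nil =>
      -- The root interval always contains `m`, so close samples never report `outside` there.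
      refine absurd ?_ hne
      have : lam ≤ pathRadius r lam 0 := by simp [pathRadius]; linarith
      simpa [pathCenter] using hm.trans this
    | cons c p =>
      have hne' : ¬ |m - c| ≤ pathRadius r lam (p.length + 1) := hne
      simp only [h, decide_true, if_true, List.tail_cons, pathPotential, if_neg hne']
      omega
  · simp only [h, decide_false, Bool.false_eq_true, if_false, pathPotential]
    rw [not_lt, abs_le] at h
    rw [if_pos]
    -- For the right child, `m` lies in `[c - r, c + R + 2r]`, where `c` and `R` are the current
    -- centre and radius. Its midpoint `c + (R + r) / 2` and half-length `(R + 3r) / 2` are exactly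
    -- those of the child; the left child is symmetric.
    rw [pathRadius_succ, abs_le]
    by_cases h2 : pathCenter p < y
    · simp only [h2, decide_true, if_true]
      constructor <;> linarith
    · simp only [h2, decide_false, Bool.false_eq_true, if_false]
      constructor <;> linarith

/-- The left side is twice the number of nodes containing `m`. Those deeper than `D` have radius at
most `4r`, so at most `D` of the containing nodes can fail to be `4r`-close to `m`. -/
theorem pathPotential_add_length_le {r lam m : ℝ} (hlam : 0 ≤ lam) {D : ℕ} (hD : lam / 2 ^ D ≤ r)
    (p : List ℝ) :
    pathPotential r lam m p + p.length ≤
      2 * (p.countP fun c => decide (|m - c| ≤ 4 * r) : ℕ) + 2 * min p.length D := by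
  induction p with
  | nil => simp [pathPotential]
  | cons c p ih =>
    simp only [pathPotential, List.length_cons, List.countP_cons]
    by_cases h : |m - c| ≤ pathRadius r lam (p.length + 1)
    · rcases lt_or_ge p.length D with h1 | h1
      · rw [if_pos h]
        split_ifs <;> push_cast <;> omega
      · have h2 : lam / 2 ^ (p.length + 1) ≤ lam / 2 ^ D :=
          div_le_div_of_nonneg_left hlam (by positivity)
            (pow_le_pow_right₀ (by norm_num) (by omega))
        have h3 : |m - c| ≤ 4 * r := h.trans (by unfold pathRadius; linarith)
        simp only [h, h3, decide_true, if_true]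
        push_cast
        omega
    · rw [if_neg h]
      split_ifs <;> push_cast <;> omega

theorem exists_of_length_lt_countP_add_countP {α : Type*} {f g : α → Bool} {l : List α}
    (h : l.length < l.countP f + l.countP g) : ∃ a, f a ∧ g a := by
  by_contra! hc
  have : l.countP f + l.countP g ≤ l.length := by
    clear h
    induction l with
    | nil => simp
    | cons a l ih =>
      have := hc a
      simp only [List.countP_cons, List.length_cons]
      cases hf : f a <;> cases hg : g a <;> simp_all <;> omega
  omega

open Classical in
/-- An integer `k` such that most nodes of the path are `5r`-close to `σ * k`, if there is one. -/
noncomputable def pathDecode (r σ : ℝ) (p : List ℝ) : ℤ :=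
  if h : ∃ k : ℤ, p.length < 2 * p.countP fun c => decide (|σ * k - c| ≤ 5 * r) then h.choose else 0

/-- A potential above `2D` makes most nodes `4r`-close to `m`, so rounding `m / σ` provides an
admissible `k`. Any admissible `k` has a majority of its own; the two majorities share a node, and
`4r + 5r = 9r`. -/
theorem abs_pathDecode_sub_le {r σ lam m : ℝ} (hσ : 0 < σ) (hr : σ ≤ r) (hlam : 0 ≤ lam) {D : ℕ}
    (hD : lam / 2 ^ D ≤ r) {p : List ℝ} (hp : 2 * (D : ℤ) < pathPotential r lam m p) :
    |σ * pathDecode r σ p - m| ≤ 9 * r := by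
  have h1 : p.length < 2 * p.countP fun c => decide (|m - c| ≤ 4 * r) := by
    have := pathPotential_add_length_le (m := m) hlam hD p
    omega
  have h2 : ∃ k : ℤ, p.length < 2 * p.countP fun c => decide (|σ * k - c| ≤ 5 * r) := by
    refine ⟨round (m / σ), h1.trans_le (Nat.mul_le_mul_left _ (List.countP_mono_left fun c _ hc => ?_))⟩
    have h3 : |m / σ - round (m / σ)| ≤ 1 / 2 := abs_sub_round _
    have h4 : |σ * round (m / σ) - m| ≤ r := by
      have : σ * round (m / σ) - m = -(σ * (m / σ - round (m / σ))) := by field_simp; ring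
      rw [this, abs_neg, abs_mul, abs_of_pos hσ]
      nlinarith
    have h5 : |m - c| ≤ 4 * r := by simpa using hc
    have := abs_sub_le (σ * round (m / σ)) m c
    exact decide_eq_true (by linarith)
  have h6 := h2.choose_spec
  obtain ⟨c, hc1, hc2⟩ := exists_of_length_lt_countP_add_countP (f := fun c => decide (|m - c| ≤ 4 * r))
    (g := fun c => decide (|σ * h2.choose - c| ≤ 5 * r)) (l := p) (by omega)
  have hk : pathDecode r σ p = h2.choose := dif_pos h2
  rw [hk]
  simp only [decide_eq_true_eq] at hc1 hc2
  have := abs_sub_le (σ * h2.choose) c m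
  rw [abs_sub_comm c m] at this
  linarith

/-! ### The search as a query rule -/

/-- The search path after the answers `l`; if their number is odd, then the second component is the
last one. -/
noncomputable def searchState (r lam : ℝ) (l : List Bool) : List ℝ × Option Bool :=
  l.foldl (fun s b => match s.2 with
    | none => (s.1, some b)
    | some b₁ => (pathStep r lam s.1 b₁ b, none)) ([], none)

/-- The query of the noisy search after the answers `l`. -/
noncomputable def searchQuery (r lam : ℝ) (l : List Bool) : Query := fun x =>
  match (searchState r lam l).2 with
  | none => decide (pathRadius r lam (searchState r lam l).1.length + r <
      |x - pathCenter (searchState r lam l).1|)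
  | some _ => decide (pathCenter (searchState r lam l).1 < x)

theorem measurable_decide_of_measurableSet {p : ℝ → Prop} [DecidablePred p]
    (hp : MeasurableSet {x | p x}) : Measurable fun x => decide (p x) :=
  measurable_to_bool (by simpa [Set.preimage] using hp)

theorem measurable_searchQuery (r lam : ℝ) (l : List Bool) : Measurable (searchQuery r lam l) := by
  unfold searchQuery
  cases (searchState r lam l).2 with
  | none => exact measurable_decide_of_measurableSet (measurableSet_lt measurable_const (by fun_prop))
  | some _ => exact measurable_decide_of_measurableSet (measurableSet_lt measurable_const (by fun_prop))

theorem searchState_append (r lam : ℝ) (l : List Bool) (b : Bool) :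
    searchState r lam (l ++ [b]) = match (searchState r lam l).2 with
      | none => ((searchState r lam l).1, some b)
      | some b₁ => (pathStep r lam (searchState r lam l).1 b₁ b, none) := by
  rw [searchState, List.foldl_append]
  rfl

open Classical in
/-- After `2k` rounds of the noisy search the potential is at least `k` minus twice the number of
samples that are not `r`-close to `m`. -/
theorem le_pathPotential_searchState {r lam m : ℝ} (hr : 0 ≤ r) (hm : |m| ≤ lam)
    {Q : List Bool → Query} {K : ℕ} (hQ : ∀ l : List Bool, l.length < 2 * K →
      Q l = searchQuery r lam l) (x : ℕ → ℝ) {k : ℕ} (hk : k ≤ K) :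
    (searchState r lam (bits Q x (2 * k))).2 = none ∧
      (k : ℤ) - 2 * ((Finset.range (2 * k)).filter fun i => r < |x i - m|).card ≤
        pathPotential r lam m (searchState r lam (bits Q x (2 * k))).1 := by
  induction k with
  | zero => simp [bits, searchState, pathPotential]
  | succ k ih =>
    obtain ⟨ih1, ih2⟩ := ih (by omega)
    set s := searchState r lam (bits Q x (2 * k)) with hs
    have hs1 : searchState r lam (bits Q x (2 * k + 1)) = (s.1, some (decide
        (pathRadius r lam s.1.length + r < |x (2 * k) - pathCenter s.1|))) := by
      rw [bits, searchState_append, ← hs, ih1, hQ _ (by simp; omega)]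
      simp only [searchQuery, ← hs, ih1]
    have hs2 : searchState r lam (bits Q x (2 * (k + 1))) = (pathStep r lam s.1
        (decide (pathRadius r lam s.1.length + r < |x (2 * k) - pathCenter s.1|))
        (decide (pathCenter s.1 < x (2 * k + 1))), none) := by
      rw [show 2 * (k + 1) = 2 * k + 1 + 1 by ring, bits, searchState_append, hs1,
        hQ _ (by simp; omega)]
      simp only [searchQuery, hs1]
    rw [hs2]
    refine ⟨rfl, ?_⟩
    rw [show 2 * (k + 1) = 2 * k + 1 + 1 by ring, Finset.range_add_one, Finset.range_add_one,
      Finset.filter_insert, Finset.filter_insert]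
    -- A step with a far sample may lose `1` instead of gaining `1`; this difference of `2` is
    -- charged to one far sample.
    by_cases h1 : r < |x (2 * k) - m| <;> by_cases h2 : r < |x (2 * k + 1) - m|
    · have := pathPotential_step_ge r lam m s.1
        (decide (pathRadius r lam s.1.length + r < |x (2 * k) - pathCenter s.1|))
        (decide (pathCenter s.1 < x (2 * k + 1)))
      simp [h1, h2]
      omega
    · have := pathPotential_step_ge r lam m s.1
        (decide (pathRadius r lam s.1.length + r < |x (2 * k) - pathCenter s.1|))
        (decide (pathCenter s.1 < x (2 * k + 1)))
      simp [h1, h2]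
      omega
    · have := pathPotential_step_ge r lam m s.1
        (decide (pathRadius r lam s.1.length + r < |x (2 * k) - pathCenter s.1|))
        (decide (pathCenter s.1 < x (2 * k + 1)))
      simp [h1, h2]
      omega
    · have := pathPotential_step_of_close hr hm s.1 (not_lt.1 h1) (not_lt.1 h2)
      simp only [h1, h2, if_false]
      push_cast
      omega

/-! ### Sub-Gaussian tails and the number of far samples -/

theorem measureReal_le_exp_of_hasSubgaussianMGF {D : Measure ℝ} {σ m : ℝ}
    (h : HasSubgaussianMGF (fun x => x - m) (Real.toNNReal (σ ^ 2)) D) {u : ℝ} (hu : 0 ≤ u) :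
    D.real {x | u ≤ x - m} ≤ Real.exp (-u ^ 2 / (2 * σ ^ 2)) ∧
      D.real {x | u ≤ m - x} ≤ Real.exp (-u ^ 2 / (2 * σ ^ 2)) := by
  have hc : ((Real.toNNReal (σ ^ 2) : NNReal) : ℝ) = σ ^ 2 := Real.coe_toNNReal _ (sq_nonneg σ)
  have h1 := h.measure_ge_le hu
  have h2 := h.neg.measure_ge_le hu
  rw [hc] at h1 h2
  refine ⟨h1, ?_⟩
  simpa using h2

theorem measureReal_lt_abs_sub_le {D : Measure ℝ} [IsProbabilityMeasure D] {σ m : ℝ}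
    (h : HasSubgaussianMGF (fun x => x - m) (Real.toNNReal (σ ^ 2)) D) {u : ℝ} (hu : 0 ≤ u) :
    D.real {x | u < |x - m|} ≤ 2 * Real.exp (-u ^ 2 / (2 * σ ^ 2)) := by
  obtain ⟨h1, h2⟩ := measureReal_le_exp_of_hasSubgaussianMGF h hu
  have h3 : D.real {x | u < |x - m|} ≤ D.real ({x | u ≤ x - m} ∪ {x | u ≤ m - x}) := by
    refine measureReal_mono fun x hx => ?_
    have hx' : u < |x - m| := hx
    rcases lt_abs.1 hx' with h | h
    · exact Or.inl h.le
    · exact Or.inr (show u ≤ m - x by linarith)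
  linarith [measureReal_union_le (μ := D) {x | u ≤ x - m} {x | u ≤ m - x}]

open Classical in
/-- Among `2K` samples, it is unlikely that `K / 4` or more are far from the mean. -/
theorem measureReal_card_far_le {D : Measure ℝ} [IsProbabilityMeasure D] {σ m r : ℝ} (hσ : 0 < σ)
    (h : HasSubgaussianMGF (fun x => x - m) (Real.toNNReal (σ ^ 2)) D) (hr : 16 * σ ≤ r) (K : ℕ) :
    (Measure.infinitePi fun _ : ℕ => D).real
      {x | (K : ℝ) ≤ 4 * ((Finset.range (2 * K)).filter fun i => r < |x i - m|).card} ≤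
      Real.exp (-(K * (r ^ 2 / (32 * σ ^ 2)))) := by
  -- The tail bound is `2 exp (-2κ)`, so weight `κ` per far sample spends half of the exponent and
  -- still leaves a factor that absorbs the `2`.
  set κ : ℝ := r ^ 2 / (4 * σ ^ 2) with hκ
  have hκ64 : 64 ≤ κ := by
    rw [hκ, le_div_iff₀ (by positivity)]
    nlinarith
  set S : Set ℝ := {y | r < |y - m|} with hS
  have hSm : MeasurableSet S := measurableSet_lt measurable_const (by fun_prop)
  have hp : D.real S * Real.exp κ ≤ 1 := by
    have h1 : D.real S ≤ 2 * Real.exp (-r ^ 2 / (2 * σ ^ 2)) :=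
      measureReal_lt_abs_sub_le h (by linarith)
    have h2 : -r ^ 2 / (2 * σ ^ 2) = -κ + -κ := by rw [hκ]; field_simp; ring
    have h3 : 2 ≤ Real.exp κ := by linarith [Real.add_one_le_exp κ]
    calc D.real S * Real.exp κ ≤ 2 * Real.exp (-κ + -κ) * Real.exp κ := by
          rw [← h2]; gcongr
      _ = 2 / Real.exp κ := by
          rw [Real.exp_add, Real.exp_neg]; field_simp
      _ ≤ 1 := (div_le_one (Real.exp_pos _)).2 h3
  have hch := chernoff_infinitePi D (Finset.range (2 * K)) (S := fun _ => S) (fun _ => hSm)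
    (fun _ => κ) (κ * (K / 4))
  refine le_trans (measureReal_mono fun x hx => ?_) (hch.trans (Real.exp_le_exp.2 ?_))
  · have hx' : (K : ℝ) ≤ 4 * ((Finset.range (2 * K)).filter fun i => r < |x i - m|).card := hx
    have hsum : ∑ j ∈ Finset.range (2 * K), κ * S.indicator 1 (x j) =
        κ * ((Finset.range (2 * K)).filter fun i => r < |x i - m|).card := by
      rw [← Finset.mul_sum, Finset.card_filter, Nat.cast_sum]
      refine congrArg _ (Finset.sum_congr rfl fun j _ => ?_)
      by_cases hj : r < |x j - m| <;> simp [hS, hj]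
    show κ * (K / 4) ≤ ∑ j ∈ Finset.range (2 * K), κ * S.indicator 1 (x j)
    rw [hsum]
    gcongr
    linarith
  · rw [Finset.sum_const, Finset.card_range, nsmul_eq_mul]
    have h4 : r ^ 2 / (32 * σ ^ 2) = κ / 8 := by rw [hκ]; field_simp; ring
    have h5 : D.real S * (Real.exp κ - 1) ≤ 1 := by
      linarith [measureReal_nonneg (μ := D) (s := S)]
    rw [h4]
    push_cast
    -- The exponent is at most `2K - κK/4`, and `κ ≥ 64` lets `κK/8` absorb `2K`.
    nlinarith [mul_le_mul_of_nonneg_left h5 (Nat.cast_nonneg (α := ℝ) K),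
      mul_le_mul_of_nonneg_left hκ64 (Nat.cast_nonneg (α := ℝ) K)]

/-! ### Threshold quantization of the positive part -/

/-- The thresholds `0 = t₀ < t₁ < ⋯ < t_M = M`. -/
noncomputable def level (M j : ℕ) : ℝ := j / (M + 1 - j)

/-- The distance between two adjacent thresholds. -/
noncomputable def levelGap (M j : ℕ) : ℝ := level M (j + 1) - level M j

theorem level_nonneg {M j : ℕ} (hj : j ≤ M) : 0 ≤ level M j := by
  have : (j : ℝ) ≤ M := by exact_mod_cast hj
  exact div_nonneg (Nat.cast_nonneg j) (by linarith)

theorem levelGap_nonneg {M j : ℕ} (hj : j < M) : 0 ≤ levelGap M j := by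
  have : (j : ℝ) + 1 ≤ M := by exact_mod_cast hj
  unfold levelGap level
  rw [sub_nonneg]
  push_cast
  gcongr <;> linarith

/-- The levels are `u / (1 - u)` at `u = j / (M + 1)`, a function with derivative `(1 + t)²` at
height `t`. The factor `2` pays for using the left endpoint. -/
theorem levelGap_le {M j : ℕ} (hj : j < M) :
    levelGap M j ≤ 2 * (1 + level M j) ^ 2 / (M + 1) := by
  have h : (j : ℝ) + 1 ≤ M := by exact_mod_cast hj
  have hj0 : (0 : ℝ) ≤ j := Nat.cast_nonneg j
  have h1 : (0 : ℝ) < M + 1 - j := by linarith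
  have h2 : (0 : ℝ) < M - j := by linarith
  have e1 : levelGap M j = (M + 1) / ((M + 1 - j) * (M - j)) := by
    unfold levelGap level
    push_cast
    rw [show (M : ℝ) + 1 - (j + 1) = M - j by ring]
    field_simp
    ring
  have e2 : 1 + level M j = (M + 1) / (M + 1 - j) := by
    unfold level
    field_simp
    ring
  rw [e1, e2, div_pow, ← mul_div_assoc, div_div, div_le_div_iff₀ (by positivity) (by positivity)]
  have h3 : (M : ℝ) + 1 - j ≤ 2 * (M - j) := by linarith
  have h4 : (0 : ℝ) ≤ (M + 1) ^ 2 * (M + 1 - j) := by positivity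
  nlinarith [mul_le_mul_of_nonneg_left h3 h4]

theorem abs_sub_sum_levelGap_le (M : ℕ) (y : ℝ) :
    |max y 0 - ∑ j ∈ Finset.range M, levelGap M j * (Set.Ici (level M (j + 1))).indicator 1 y| ≤
      2 * (1 + max y 0) ^ 2 / (M + 1) := by
  have hM : (0 : ℝ) < M + 1 := by positivity
  rcases lt_or_ge y 0 with hy | hy
  · rw [max_eq_right hy.le, Finset.sum_eq_zero]
    · simp; positivity
    · intro j hj
      have := level_nonneg (M := M) (j := j + 1) (Finset.mem_range.1 hj)
      rw [Set.indicator_of_notMem (by simp; linarith), mul_zero]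
  rw [max_eq_left hy]
  -- The gaps telescope to the last threshold not exceeding `y`, so the error is below one gap; once
  -- `y` is passed, further terms vanish.
  have key : ∀ k ≤ M,
      (level M k ≤ y ∧ ∑ j ∈ Finset.range k,
        levelGap M j * (Set.Ici (level M (j + 1))).indicator (1 : ℝ → ℝ) y = level M k) ∨
      (y < level M k ∧ |y - ∑ j ∈ Finset.range k,
        levelGap M j * (Set.Ici (level M (j + 1))).indicator (1 : ℝ → ℝ) y| ≤
          2 * (1 + y) ^ 2 / (M + 1)) := by
    intro k
    induction k with
    | zero => exact fun _ => Or.inl (by simpa [level] using hy)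
    | succ k ih =>
      intro hk
      have hg := levelGap_nonneg hk
      rw [Finset.sum_range_succ]
      rcases ih (by omega) with ⟨h1, h2⟩ | ⟨h1, h2⟩
      · rw [h2]
        rcases le_or_gt (level M (k + 1)) y with h3 | h3
        · refine Or.inl ⟨h3, ?_⟩
          rw [Set.indicator_of_mem (Set.mem_Ici.2 h3)]
          simp [levelGap]
        · refine Or.inr ⟨h3, ?_⟩
          rw [Set.indicator_of_notMem (by simpa using h3), mul_zero, add_zero,
            abs_of_nonneg (by linarith)]
          have h4 := levelGap_le hk
          have h5 : 2 * (1 + level M k) ^ 2 / (M + 1) ≤ 2 * (1 + y) ^ 2 / (M + 1) := by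
            have := level_nonneg (M := M) (j := k) (by omega)
            gcongr
          unfold levelGap at h4
          linarith
      · have h3 : y < level M (k + 1) := by unfold levelGap at hg; linarith
        refine Or.inr ⟨h3, ?_⟩
        rwa [Set.indicator_of_notMem (by simpa using h3), mul_zero, add_zero]
  rcases key M le_rfl with ⟨h1, h2⟩ | ⟨_, h2⟩
  · have h3 : level M M = M := by simp [level]
    rw [h2, abs_of_nonneg (by linarith), h3, le_div_iff₀ hM]
    rw [h3] at h1
    nlinarith
  · exact h2

/-! ### Deviation and bias of the threshold sum -/

theorem exp_sub_one_sub_le (u : ℝ) : Real.exp u - 1 - u ≤ u ^ 2 * Real.exp |u| := by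
  have h1 : Real.exp u - 1 ≤ u * Real.exp u := by
    have h := mul_le_mul_of_nonneg_right (Real.one_sub_le_exp_neg u) (Real.exp_pos u).le
    rw [← Real.exp_add, neg_add_cancel, Real.exp_zero] at h
    linarith
  have h2 := Real.add_one_le_exp u
  rcases le_total 0 u with hu | hu
  · rw [abs_of_nonneg hu]
    nlinarith
  · have h3 : 1 ≤ Real.exp |u| := Real.one_le_exp (abs_nonneg u)
    nlinarith [sq_nonneg u]

/-- The variance proxy of the refinement when the distance of the centre from the mean is at most
`a` times the scale. -/
noncomputable def refineConst (a : ℝ) : ℝ := 2048 * Real.exp (1 / 4 + a ^ 2 / 2)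

theorem refineConst_pos (a : ℝ) : 0 < refineConst a := by unfold refineConst; positivity

/-- The centred exponential is about `v²`, of order `s² (1 + t²)² / (M + 1)²`. The tail `exp (-t² /
4)` pays for this polynomial and for `exp |v|`, each bounded through `exp ((1 + t²) / 8)`; the
powers of `t` in the exponent cancel exactly. -/
theorem mul_exp_levelGap_le {a s p v : ℝ} {M j : ℕ} (hj : j < M) (hs : 0 ≤ s)
    (hsM : 32 * s ≤ M + 1) (hp : p ≤ Real.exp (a ^ 2 / 2 - level M (j + 1) ^ 2 / 4)) (hp0 : 0 ≤ p)
    (hv : |v| = s * levelGap M j) :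
    p * (Real.exp v - 1 - v) ≤ refineConst a * s ^ 2 / (M + 1) ^ 2 := by
  set t := level M (j + 1) with ht
  have hN : (0 : ℝ) < M + 1 := by positivity
  set q := s / (M + 1) with hq
  have hq0 : 0 ≤ q := by positivity
  have hq1 : 32 * q ≤ 1 := by rw [hq, ← mul_div_assoc, div_le_one hN]; exact hsM
  have ht0 : 0 ≤ level M j := level_nonneg hj.le
  have htt : level M j ≤ t := by have := levelGap_nonneg hj; unfold levelGap at this; linarith
  have hvle : |v| ≤ q * (4 * (1 + t ^ 2)) := by
    have h1 : s * levelGap M j ≤ s * (2 * (1 + level M j) ^ 2 / (M + 1)) :=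
      mul_le_mul_of_nonneg_left (levelGap_le hj) hs
    have h2 : s * (2 * (1 + level M j) ^ 2 / (M + 1)) = q * (2 * (1 + level M j) ^ 2) := by
      rw [hq]; ring
    have h3 : 2 * (1 + level M j) ^ 2 ≤ 4 * (1 + t ^ 2) := by nlinarith [sq_nonneg (t - 1)]
    rw [hv]
    linarith [mul_le_mul_of_nonneg_left h3 hq0]
  have hv8 : |v| ≤ (1 + t ^ 2) / 8 := by nlinarith [sq_nonneg t]
  have hvsq : v ^ 2 ≤ 16 * q ^ 2 * (1 + t ^ 2) ^ 2 := by
    rw [← sq_abs]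
    calc |v| ^ 2 ≤ (q * (4 * (1 + t ^ 2))) ^ 2 := by gcongr
      _ = _ := by ring
  have hpoly : (1 + t ^ 2) ^ 2 ≤ 128 * Real.exp ((1 + t ^ 2) / 8) := by
    have := Real.quadratic_le_exp_of_nonneg (x := (1 + t ^ 2) / 8) (by positivity)
    nlinarith [sq_nonneg t]
  calc p * (Real.exp v - 1 - v) ≤ p * (v ^ 2 * Real.exp |v|) := by
        gcongr; exact exp_sub_one_sub_le v
    _ ≤ Real.exp (a ^ 2 / 2 - t ^ 2 / 4) *
          (16 * q ^ 2 * (128 * Real.exp ((1 + t ^ 2) / 8)) * Real.exp ((1 + t ^ 2) / 8)) := by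
        have : v ^ 2 ≤ 16 * q ^ 2 * (128 * Real.exp ((1 + t ^ 2) / 8)) :=
          hvsq.trans (mul_le_mul_of_nonneg_left hpoly (by positivity))
        gcongr
    _ = 2048 * q ^ 2 * (Real.exp (a ^ 2 / 2 - t ^ 2 / 4) * Real.exp ((1 + t ^ 2) / 8) *
          Real.exp ((1 + t ^ 2) / 8)) := by ring
    _ = 2048 * q ^ 2 * Real.exp (1 / 4 + a ^ 2 / 2) := by
        rw [← Real.exp_add, ← Real.exp_add]; congr 2; ring
    _ = refineConst a * s ^ 2 / (M + 1) ^ 2 := by rw [hq, refineConst, div_pow]; ring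

/-- The deviation of the weighted sum of threshold bits from its mean. -/
theorem measureReal_lt_abs_sum_levelGap_sub_le {D : Measure ℝ} [IsProbabilityMeasure D]
    {V : ℝ → ℝ} (hV : Measurable V) {a η : ℝ} (hη : 0 ≤ η) (hηa : 16 * η ≤ refineConst a)
    (htail : ∀ t, 0 ≤ t → D.real {y | t ≤ V y} ≤ Real.exp (a ^ 2 / 2 - t ^ 2 / 4)) (o M : ℕ) :
    (Measure.infinitePi fun _ : ℕ => D).real {x | η < |∑ j ∈ Finset.range M,
        levelGap M j * (Set.Ici (level M (j + 1))).indicator 1 (V (x (o + j))) -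
        ∑ j ∈ Finset.range M, levelGap M j * D.real {y | level M (j + 1) ≤ V y}|} ≤
      2 * Real.exp (-((M + 1) * (η ^ 2 / (4 * refineConst a)))) := by
  set κ := refineConst a with hκ
  have hκ0 : 0 < κ := refineConst_pos a
  have hN : (0 : ℝ) < M + 1 := by positivity
  -- This `s` minimizes `κ s² / (M + 1) - s η`, with value `-(M + 1) η² / (4κ)`.
  set s : ℝ := (M + 1) * (η / (2 * κ)) with hs
  have hs0 : 0 ≤ s := by positivity
  have hs32 : 32 * s ≤ M + 1 := by
    have : 32 * (η / (2 * κ)) ≤ 1 := by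
      rw [← mul_div_assoc, div_le_one (by positivity)]; linarith
    rw [hs]
    nlinarith
  set S : ℕ → Set ℝ := fun j => {y | level M (j + 1) ≤ V y} with hS
  have hSm : ∀ j, MeasurableSet (S j) := fun j => measurableSet_le measurable_const hV
  have hind : ∀ j y, (Set.Ici (level M (j + 1))).indicator (1 : ℝ → ℝ) (V y) =
      (S j).indicator 1 y := fun j y => by
    by_cases h : level M (j + 1) ≤ V y <;> simp [hS, h]
  have side : ∀ e : ℝ, |e| = 1 → (Measure.infinitePi fun _ : ℕ => D).real
      {x | e * (∑ j ∈ Finset.range M, levelGap M j * D.real (S j)) + η ≤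
        e * ∑ j ∈ Finset.range M, levelGap M j * (S j).indicator 1 (x (o + j))} ≤
      Real.exp (-((M + 1) * (η ^ 2 / (4 * κ)))) := by
    intro e he
    have hch := chernoff_infinitePi D ((Finset.range M).map (addLeftEmbedding o))
      (S := fun i => S (i - o)) (fun i => hSm _) (fun i => s * (e * levelGap M (i - o)))
      (s * (e * (∑ j ∈ Finset.range M, levelGap M j * D.real (S j)) + η))
    simp only [Finset.sum_map, addLeftEmbedding_apply, add_tsub_cancel_left] at hch
    refine le_trans (measureReal_mono fun x hx => ?_) (hch.trans (Real.exp_le_exp.2 ?_))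
    · have hx' : e * (∑ j ∈ Finset.range M, levelGap M j * D.real (S j)) + η ≤
        e * ∑ j ∈ Finset.range M, levelGap M j * (S j).indicator 1 (x (o + j)) := hx
      have h1 := mul_le_mul_of_nonneg_left hx' hs0
      have h2 : s * (e * ∑ j ∈ Finset.range M, levelGap M j * (S j).indicator 1 (x (o + j))) =
          ∑ j ∈ Finset.range M, s * (e * levelGap M j) * (S j).indicator 1 (x (o + j)) := by
        rw [Finset.mul_sum, Finset.mul_sum]
        exact Finset.sum_congr rfl fun j _ => by ring
      rw [h2] at h1
      exact h1
    · have h1 : ∑ j ∈ Finset.range M, D.real (S j) * (Real.exp (s * (e * levelGap M j)) - 1) -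
          s * (e * (∑ j ∈ Finset.range M, levelGap M j * D.real (S j)) + η) =
          ∑ j ∈ Finset.range M, D.real (S j) *
            (Real.exp (s * (e * levelGap M j)) - 1 - s * (e * levelGap M j)) - s * η := by
        rw [mul_add, Finset.mul_sum, Finset.mul_sum, ← sub_sub, ← Finset.sum_sub_distrib]
        congr 1
        exact Finset.sum_congr rfl fun j _ => by ring
      have h2 : ∑ j ∈ Finset.range M, D.real (S j) *
            (Real.exp (s * (e * levelGap M j)) - 1 - s * (e * levelGap M j)) ≤
          M * (κ * s ^ 2 / (M + 1) ^ 2) := by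
        refine (Finset.sum_le_card_nsmul _ _ (κ * s ^ 2 / (M + 1) ^ 2) fun j hj => ?_).trans
          (by simp)
        have hj' := Finset.mem_range.1 hj
        refine mul_exp_levelGap_le hj' hs0 hs32 (htail _ (level_nonneg hj')) measureReal_nonneg ?_
        rw [abs_mul s, abs_mul e, he, abs_of_nonneg hs0, abs_of_nonneg (levelGap_nonneg hj'), one_mul]
      have h3 : (M : ℝ) * (κ * s ^ 2 / (M + 1) ^ 2) ≤ (M + 1) * (κ * s ^ 2 / (M + 1) ^ 2) := by
        gcongr; linarith
      have h4 : ((M : ℝ) + 1) * (κ * s ^ 2 / (M + 1) ^ 2) - s * η =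
          -((M + 1) * (η ^ 2 / (4 * κ))) := by
        rw [hs]; field_simp; ring
      rw [h1]
      linarith
  have h1 := side 1 abs_one
  have h2 := side (-1) (by simp)
  simp only [hind]
  refine (measureReal_mono fun x hx => ?_).trans ((measureReal_union_le _ _).trans
    ((add_le_add h1 h2).trans_eq (two_mul _).symm))
  have hx' : η < |∑ j ∈ Finset.range M, levelGap M j * (S j).indicator 1 (x (o + j)) -
        ∑ j ∈ Finset.range M, levelGap M j * D.real (S j)| := hx
  rcases lt_abs.1 hx' with h | h
  · left
    show 1 * (∑ j ∈ Finset.range M, levelGap M j * D.real (S j)) + η ≤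
        1 * ∑ j ∈ Finset.range M, levelGap M j * (S j).indicator 1 (x (o + j))
    linarith
  · right
    show -1 * (∑ j ∈ Finset.range M, levelGap M j * D.real (S j)) + η ≤
        -1 * ∑ j ∈ Finset.range M, levelGap M j * (S j).indicator 1 (x (o + j))
    linarith

/-- The pointwise quantization error is quadratic in `V`, so it integrates to a second moment over
`M + 1`. -/
theorem abs_integral_max_sub_sum_levelGap_le {D : Measure ℝ} [IsProbabilityMeasure D]
    {V : ℝ → ℝ} (hV : Measurable V) (hV1 : Integrable V D) (hV2 : Integrable (fun y => V y ^ 2) D)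
    (M : ℕ) :
    |∫ y, max (V y) 0 ∂D - ∑ j ∈ Finset.range M, levelGap M j * D.real {y | level M (j + 1) ≤ V y}|
      ≤ (4 + 4 * ∫ y, V y ^ 2 ∂D) / (M + 1) := by
  have hSm : ∀ j, MeasurableSet {y | level M (j + 1) ≤ V y} := fun j =>
    measurableSet_le measurable_const hV
  have hpos : Integrable (fun y => max (V y) 0) D := hV1.pos_part
  have hterm : ∀ j, Integrable
      (fun y => levelGap M j * (Set.Ici (level M (j + 1))).indicator (1 : ℝ → ℝ) (V y)) D := by
    intro j
    refine Integrable.const_mul ?_ _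
    exact ((integrable_const (1 : ℝ)).indicator (hSm j)).congr (.of_forall fun y => by
      by_cases h : level M (j + 1) ≤ V y <;> simp [h])
  have hint : ∀ j, ∫ y, levelGap M j * (Set.Ici (level M (j + 1))).indicator (1 : ℝ → ℝ) (V y) ∂D =
      levelGap M j * D.real {y | level M (j + 1) ≤ V y} := by
    intro j
    rw [integral_const_mul, ← integral_indicator_one (hSm j)]
    refine congrArg _ (integral_congr_ae (.of_forall fun y => ?_))
    by_cases h : level M (j + 1) ≤ V y <;> simp [h]
  have hsum : ∑ j ∈ Finset.range M, levelGap M j * D.real {y | level M (j + 1) ≤ V y} =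
      ∫ y, ∑ j ∈ Finset.range M,
        levelGap M j * (Set.Ici (level M (j + 1))).indicator (1 : ℝ → ℝ) (V y) ∂D := by
    rw [integral_finsetSum _ fun j _ => hterm j]
    exact Finset.sum_congr rfl fun j _ => (hint j).symm
  rw [hsum, ← integral_sub hpos (integrable_finsetSum _ fun j _ => hterm j)]
  refine abs_integral_le_integral_abs.trans ?_
  have hbd : ∫ y, (4 + 4 * V y ^ 2) / (M + 1) ∂D = (4 + 4 * ∫ y, V y ^ 2 ∂D) / (M + 1) := by
    rw [integral_div, integral_add (integrable_const _) (hV2.const_mul _), integral_const_mul]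
    simp
  rw [← hbd]
  refine integral_mono_of_nonneg (.of_forall fun y => abs_nonneg _)
    (((integrable_const _).add (hV2.const_mul _)).div_const _) (.of_forall fun y => ?_)
  refine (abs_sub_sum_levelGap_le M (V y)).trans ?_
  dsimp only
  gcongr
  have h1 : max (V y) 0 ^ 2 ≤ V y ^ 2 := by
    rcases le_total (V y) 0 with h | h
    · simp [max_eq_right h, sq_nonneg]
    · simp [max_eq_left h]
  nlinarith [sq_nonneg (max (V y) 0 - 1)]

/-! ### The refined estimate around a fixed centre -/

theorem measureReal_le_div_exp {D : Measure ℝ} [IsProbabilityMeasure D] {σ m c a e : ℝ}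
    (hσ : 0 < σ) (h : HasSubgaussianMGF (fun x => x - m) (Real.toNNReal (σ ^ 2)) D)
    (hc : |c - m| ≤ a * σ) (he : e = 1 ∨ e = -1) {t : ℝ} (ht : 0 ≤ t) :
    D.real {y | t ≤ e * ((y - c) / σ)} ≤ Real.exp (a ^ 2 / 2 - t ^ 2 / 4) := by
  rcases lt_or_ge t a with hta | hta
  · exact measureReal_le_one.trans (Real.one_le_exp (by nlinarith))
  rw [abs_le] at hc
  obtain ⟨h1, h2⟩ := measureReal_le_exp_of_hasSubgaussianMGF h
    (u := σ * (t - a)) (mul_nonneg hσ.le (by linarith))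
  have h3 : Real.exp (-(σ * (t - a)) ^ 2 / (2 * σ ^ 2)) ≤ Real.exp (a ^ 2 / 2 - t ^ 2 / 4) := by
    have : -(σ * (t - a)) ^ 2 / (2 * σ ^ 2) = -(t - a) ^ 2 / 2 := by field_simp
    rw [this, Real.exp_le_exp]
    -- Shifting the centre costs half the Gaussian exponent: `(t - a)² / 2 - (t² / 4 - a² / 2) = (t
    -- - 2a)² / 4`.
    nlinarith [sq_nonneg (t - 2 * a)]
  rcases he with rfl | rfl
  · refine (measureReal_mono fun y hy => ?_).trans (h1.trans h3)
    have hy' : t ≤ 1 * ((y - c) / σ) := hy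
    rw [one_mul, le_div_iff₀ hσ] at hy'
    show σ * (t - a) ≤ y - m
    linarith
  · refine (measureReal_mono fun y hy => ?_).trans (h2.trans h3)
    have hy' : t ≤ -1 * ((y - c) / σ) := hy
    rw [neg_one_mul, ← neg_div, le_div_iff₀ hσ] at hy'
    show σ * (t - a) ≤ m - y
    linarith

theorem sq_le_exp_add_exp_neg (u : ℝ) : u ^ 2 ≤ Real.exp u + Real.exp (-u) := by
  have key : ∀ v : ℝ, 0 ≤ v → v ^ 2 ≤ Real.exp v + Real.exp (-v) := by
    intro v hv
    have h1 := Real.sum_le_exp_of_nonneg hv 4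
    simp [Finset.sum_range_succ, Nat.factorial] at h1
    nlinarith [Real.one_sub_le_exp_neg v, mul_nonneg hv (sq_nonneg (v - 2)), sq_nonneg (v - 2)]
  rcases le_total 0 u with h | h
  · exact key u h
  · simpa [add_comm] using key (-u) (by linarith)

theorem integral_sq_le_of_hasSubgaussianMGF {D : Measure ℝ} [IsProbabilityMeasure D] {σ m c a : ℝ}
    (hσ : 0 < σ) (h : HasSubgaussianMGF (fun x => x - m) (Real.toNNReal (σ ^ 2)) D)
    (hc : |c - m| ≤ a * σ) :
    Integrable (fun y => ((y - c) / σ) ^ 2) D ∧ ∫ y, ((y - c) / σ) ^ 2 ∂D ≤ 8 + 2 * a ^ 2 := by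
  have hcoe : ((Real.toNNReal (σ ^ 2) : NNReal) : ℝ) = σ ^ 2 := Real.coe_toNNReal _ (sq_nonneg σ)
  have hsq : ((c - m) / σ) ^ 2 ≤ a ^ 2 := by
    rw [sq_le_sq, abs_div, abs_of_pos hσ]
    exact ((div_le_iff₀ hσ).2 hc).trans (le_abs_self a)
  have hint : ∀ t, Integrable (fun y => Real.exp (t * (y - m))) D := h.integrable_exp_mul
  have hmgf : ∀ e : ℝ, e ^ 2 = 1 → ∫ y, Real.exp (e / σ * (y - m)) ∂D ≤ 2 := by
    intro e he
    refine (h.mgf_le (e / σ)).trans ?_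
    rw [hcoe, div_pow, he]
    have : σ ^ 2 * (1 / σ ^ 2) / 2 = 1 / 2 := by field_simp
    rw [this]
    have h1 : Real.exp (1 / 2) * Real.exp (1 / 2) = Real.exp 1 := by
      rw [← Real.exp_add]; norm_num
    nlinarith [Real.exp_one_lt_d9, Real.exp_pos (1 / 2)]
  have hptw : ∀ y, ((y - c) / σ) ^ 2 ≤
      2 * (Real.exp (1 / σ * (y - m)) + Real.exp (-1 / σ * (y - m))) + 2 * a ^ 2 := by
    intro y
    set u := (y - m) / σ with hu
    have e1 : 1 / σ * (y - m) = u := by rw [hu]; ring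
    have e2 : -1 / σ * (y - m) = -u := by rw [hu]; ring
    have e3 : (y - c) / σ = u - (c - m) / σ := by rw [hu]; ring
    rw [e1, e2, e3]
    have h1 := sq_le_exp_add_exp_neg u
    nlinarith [sq_nonneg (u + (c - m) / σ)]
  have hdom : Integrable (fun y => 2 * (Real.exp (1 / σ * (y - m)) + Real.exp (-1 / σ * (y - m))) +
      2 * a ^ 2) D := (((hint _).add (hint _)).const_mul 2).add (integrable_const _)
  have hI : Integrable (fun y => ((y - c) / σ) ^ 2) D := by
    refine hdom.mono' (Measurable.aestronglyMeasurable (by fun_prop)) (.of_forall fun y => ?_)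
    rw [Real.norm_eq_abs, abs_of_nonneg (sq_nonneg _)]
    exact hptw y
  refine ⟨hI, (integral_mono hI hdom hptw).trans ?_⟩
  rw [integral_add (by exact ((hint _).add (hint _)).const_mul 2) (integrable_const _),
    integral_const_mul, integral_add (hint _) (hint _)]
  simp only [integral_const, probReal_univ, smul_eq_mul, one_mul]
  linarith [hmgf 1 (by norm_num), hmgf (-1) (by norm_num)]

/-- The refined estimate around `c` that is computed from one threshold bit for each of the samples
`x o, …, x (o + 2M - 1)`. -/
noncomputable def refinedEstimate (σ c : ℝ) (o M : ℕ) (x : ℕ → ℝ) : ℝ :=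
  c + σ * (∑ j ∈ Finset.range M, levelGap M j *
      (Set.Ici (level M (j + 1))).indicator 1 (1 * ((x (o + j) - c) / σ)) -
    ∑ j ∈ Finset.range M, levelGap M j *
      (Set.Ici (level M (j + 1))).indicator 1 (-1 * ((x (o + M + j) - c) / σ)))

/-- Positive and negative parts are estimated from disjoint blocks of samples; each contributes a
deviation `η` and a bias, where `36 + 8a² = 4 + 4 (8 + 2a²)` comes from the second moment. Here `c`
is fixed, not random. -/
theorem measureReal_lt_abs_refinedEstimate_sub_le {D : Measure ℝ} [IsProbabilityMeasure D]
    {σ m c a η : ℝ} (hσ : 0 < σ) (hm : ∫ y, y ∂D = m)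
    (h : HasSubgaussianMGF (fun x => x - m) (Real.toNNReal (σ ^ 2)) D)
    (hc : |c - m| ≤ a * σ) (hη : 0 ≤ η) (hηa : 16 * η ≤ refineConst a) (o M : ℕ) :
    (Measure.infinitePi fun _ : ℕ => D).real
      {x | σ * (2 * (η + (36 + 8 * a ^ 2) / (M + 1))) < |refinedEstimate σ c o M x - m|} ≤
      4 * Real.exp (-((M + 1) * (η ^ 2 / (4 * refineConst a)))) := by
  obtain ⟨hI2, hB⟩ := integral_sq_le_of_hasSubgaussianMGF hσ h hc
  have hid : Integrable (fun y : ℝ => y) D := by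
    exact (h.integrable.add (integrable_const m)).congr (.of_forall fun y => by simp)
  have hI1 : Integrable (fun y => (y - c) / σ) D := (hid.sub (integrable_const c)).div_const σ
  have hmean : ∫ y, (y - c) / σ ∂D = (m - c) / σ := by
    rw [integral_div, integral_sub hid (integrable_const c), hm]
    simp
  have hmeas : ∀ e : ℝ, Measurable fun y : ℝ => e * ((y - c) / σ) := fun e => by fun_prop
  have hbias : ∀ e : ℝ, e ^ 2 = 1 → |∫ y, max (e * ((y - c) / σ)) 0 ∂D -
      ∑ j ∈ Finset.range M, levelGap M j * D.real {y | level M (j + 1) ≤ e * ((y - c) / σ)}| ≤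
      (36 + 8 * a ^ 2) / (M + 1) := by
    intro e he
    have e2 : ∀ y, (e * ((y - c) / σ)) ^ 2 = ((y - c) / σ) ^ 2 := fun y => by
      rw [mul_pow, he, one_mul]
    have := abs_integral_max_sub_sum_levelGap_le (hmeas e) (hI1.const_mul e)
      (by simpa only [e2] using hI2) M
    refine this.trans ?_
    simp only [e2]
    exact div_le_div_of_nonneg_right (by linarith) (by positivity)
  have hdiff : ∫ y, max (1 * ((y - c) / σ)) 0 ∂D - ∫ y, max (-1 * ((y - c) / σ)) 0 ∂D =
      (m - c) / σ := by
    rw [← hmean, ← integral_sub (hI1.const_mul 1).pos_part (hI1.const_mul (-1)).pos_part]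
    refine integral_congr_ae (.of_forall fun y => ?_)
    simp only [one_mul, neg_one_mul]
    exact max_zero_sub_eq_self _
  have hp := measureReal_lt_abs_sum_levelGap_sub_le (D := D) (hmeas 1) hη hηa
    (fun t ht => measureReal_le_div_exp hσ h hc (Or.inl rfl) ht) o M
  have hn := measureReal_lt_abs_sum_levelGap_sub_le (D := D) (hmeas (-1)) hη hηa
    (fun t ht => measureReal_le_div_exp hσ h hc (Or.inr rfl) ht) (o + M) M
  refine (measureReal_mono fun x hx => ?_).trans ((measureReal_union_le _ _).trans
    ((add_le_add hp hn).trans_eq (by ring)))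
  by_contra hcon
  simp only [Set.mem_union, not_or] at hcon
  obtain ⟨hx1, hx2⟩ := hcon
  have hx' : σ * (2 * (η + (36 + 8 * a ^ 2) / (M + 1))) < |refinedEstimate σ c o M x - m| := hx
  have hx1' := not_lt.1 (show ¬ η < _ from hx1)
  have hx2' := not_lt.1 (show ¬ η < _ from hx2)
  have hb1 := hbias 1 (by norm_num)
  have hb2 := hbias (-1) (by norm_num)
  rw [abs_le] at hx1' hx2' hb1 hb2
  have hm' : m = c + σ * ((m - c) / σ) := by field_simp; ring
  refine absurd hx' (not_lt.2 ?_)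
  rw [hm', ← hdiff, refinedEstimate, add_sub_add_left_eq_sub, ← mul_sub, abs_mul, abs_of_pos hσ]
  gcongr
  rw [abs_le]
  constructor <;> linarith

/-! ### The combined estimator and its guarantees -/

/-- The coarse estimate of the mean, a multiple of `σ`, after the answers `l` to the search. -/
noncomputable def coarseEstimate (r lam σ : ℝ) (l : List Bool) : ℝ :=
  σ * pathDecode r σ (searchState r lam l).1

/-- A noisy search in the first `2K` rounds is followed by `2M` threshold queries around the coarse
estimate. -/
noncomputable def estimatorQuery (r lam σ : ℝ) (K M : ℕ) (l : List Bool) : Query := fun y =>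
  if l.length < 2 * K then searchQuery r lam l y
  else if l.length < 2 * K + M then
    decide (level M (l.length - 2 * K + 1) ≤
      1 * ((y - coarseEstimate r lam σ (l.take (2 * K))) / σ))
  else
    decide (level M (l.length - (2 * K + M) + 1) ≤
      -1 * ((y - coarseEstimate r lam σ (l.take (2 * K))) / σ))

/-- The estimate that belongs to `estimatorQuery`. -/
noncomputable def estimatorValue (r lam σ : ℝ) (K M : ℕ) (l : List Bool) : ℝ :=
  coarseEstimate r lam σ (l.take (2 * K)) + σ *
    (∑ j ∈ Finset.range M, levelGap M j * (if l.getD (2 * K + j) false then 1 else 0) -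
      ∑ j ∈ Finset.range M, levelGap M j * (if l.getD (2 * K + M + j) false then 1 else 0))

theorem measurable_estimatorQuery (r lam σ : ℝ) (K M : ℕ) (l : List Bool) :
    Measurable (estimatorQuery r lam σ K M l) := by
  unfold estimatorQuery
  split_ifs
  · exact measurable_searchQuery r lam l
  · exact measurable_decide_of_measurableSet (measurableSet_le measurable_const (by fun_prop))
  · exact measurable_decide_of_measurableSet (measurableSet_le measurable_const (by fun_prop))

theorem estimatorValue_bits (r lam σ : ℝ) (K M : ℕ) (x : ℕ → ℝ) :
    estimatorValue r lam σ K M (bits (estimatorQuery r lam σ K M) x (2 * K + 2 * M)) =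
      refinedEstimate σ (coarseEstimate r lam σ (bits (estimatorQuery r lam σ K M) x (2 * K)))
        (2 * K) M x := by
  unfold estimatorValue refinedEstimate
  rw [take_bits _ _ (by omega)]
  refine congrArg _ (congrArg _ (congrArg₂ _ ?_ ?_))
  · refine Finset.sum_congr rfl fun j hj => congrArg _ ?_
    have hj' := Finset.mem_range.1 hj
    have e : estimatorQuery r lam σ K M (bits (estimatorQuery r lam σ K M) x (2 * K + j)) =
        fun y => decide (level M (j + 1) ≤ 1 * ((y - coarseEstimate r lam σ
          (bits (estimatorQuery r lam σ K M) x (2 * K))) / σ)) := by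
      funext y
      conv_lhs => unfold estimatorQuery
      rw [length_bits, if_neg (by omega), if_pos (by omega), Nat.add_sub_cancel_left]
      change decide (_ ≤ 1 * ((y - coarseEstimate r lam σ
        ((bits (estimatorQuery r lam σ K M) x (2 * K + j)).take (2 * K))) / σ)) = _
      rw [take_bits _ _ (by omega)]
    rw [getD_bits _ x (by omega), e]
    simp [Set.indicator_apply]
  · refine Finset.sum_congr rfl fun j hj => congrArg _ ?_
    have hj' := Finset.mem_range.1 hj
    have e : estimatorQuery r lam σ K M (bits (estimatorQuery r lam σ K M) x (2 * K + M + j)) =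
        fun y => decide (level M (j + 1) ≤ -1 * ((y - coarseEstimate r lam σ
          (bits (estimatorQuery r lam σ K M) x (2 * K))) / σ)) := by
      funext y
      conv_lhs => unfold estimatorQuery
      rw [length_bits, if_neg (by omega), if_neg (by omega), Nat.add_sub_cancel_left]
      change decide (_ ≤ -1 * ((y - coarseEstimate r lam σ
        ((bits (estimatorQuery r lam σ K M) x (2 * K + M + j)).take (2 * K))) / σ)) = _
      rw [take_bits _ _ (by omega)]
    rw [getD_bits _ x (by omega), e]
    simp [Set.indicator_apply]

-- With fewer than `K / 4` far samples the potential exceeds `K - K / 2 ≥ 2d`, the threshold for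
-- decoding.
open Classical in
theorem abs_pathDecode_searchState_sub_le {r lam σ m : ℝ} (hσ : 0 < σ) (hr : σ ≤ r)
    (hm : |m| ≤ lam) {d K M : ℕ} (hd : lam / 2 ^ d ≤ r) (hK : 4 * d ≤ K) {x : ℕ → ℝ}
    (hx : 4 * ((Finset.range (2 * K)).filter fun i => r < |x i - m|).card < K) :
    |σ * pathDecode r σ (searchState r lam
      (bits (estimatorQuery r lam σ K M) x (2 * K))).1 - m| ≤ 9 * r := by
  refine abs_pathDecode_sub_le hσ hr ((abs_nonneg m).trans hm) hd ?_
  have h := (le_pathPotential_searchState (hσ.le.trans hr) hm (Q := estimatorQuery r lam σ K M)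
    (K := K) (fun l hl => by funext y; simp [estimatorQuery, hl]) x le_rfl).2
  omega

/-- The search alone, at a resolution `ε` that is large compared with `σ`. -/
theorem isPAC_search {lam σ ε δ : ℝ} (hσ : 0 < σ) (hε : 144 * σ ≤ ε) (hδ : 0 < δ) {d K : ℕ}
    (hd : lam / 2 ^ d ≤ σ) (hK : 4 * d ≤ K)
    (hKδ : 2592 * (σ ^ 2 / ε ^ 2 * Real.log (1 / δ)) ≤ K) :
    (detEstimator _ (measurable_estimatorQuery (ε / 9) lam σ K 0)
      (estimatorValue (ε / 9) lam σ K 0) (2 * K + 2 * 0)).IsPAC ε δ (subGaussianFamily lam σ) := by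
  classical
  have hε0 : 0 < ε := by linarith
  refine isPAC_detEstimator _ fun D hD => ?_
  obtain ⟨hm, hsub⟩ := hD
  refine ⟨_, (measureReal_card_far_le hσ hsub (r := ε / 9) (by linarith) K).trans ?_,
    fun x hx => ?_⟩
  · rw [← Real.le_log_iff_exp_le hδ, neg_le, ← Real.log_inv, ← one_div]
    -- The constant is `2592 = 81 * 32`.
    have e : (ε / 9) ^ 2 / (32 * σ ^ 2) * (2592 * (σ ^ 2 / ε ^ 2 * Real.log (1 / δ))) =
        Real.log (1 / δ) := by field_simp; norm_num
    rw [← e, mul_comm (K : ℝ)]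
    gcongr
  · have hx' := not_le.1 (show ¬ (K : ℝ) ≤ _ from hx)
    have h := abs_pathDecode_searchState_sub_le (r := ε / 9) (M := 0) hσ (by linarith)
      (abs_le.2 hm) (hd.trans (by linarith)) hK (x := x) (by exact_mod_cast hx')
    rw [estimatorValue_bits]
    simp only [refinedEstimate, Finset.range_zero, Finset.sum_empty, sub_zero, mul_zero, add_zero]
    exact h.trans (by linarith)

theorem card_Icc_ceil_floor_le (u w : ℝ) (hw : 0 ≤ w) :
    ((Finset.Icc ⌈u - w⌉ ⌊u + w⌋).card : ℝ) ≤ 2 * w + 1 := by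
  rw [Int.card_Icc]
  have h1 := Int.floor_le (u + w)
  have h2 := Int.le_ceil (u - w)
  have h3 : (((⌊u + w⌋ + 1 - ⌈u - w⌉).toNat : ℤ) : ℝ) = max ((⌊u + w⌋ + 1 - ⌈u - w⌉ : ℤ) : ℝ) 0 := by
    rw [Int.toNat_eq_max]; push_cast; rfl
  rw [← Int.cast_natCast, h3]
  refine max_le ?_ (by linarith)
  push_cast
  linarith

/-- The search at resolution `16σ`, followed by the refinement. -/
theorem isPAC_refine {lam σ ε δ : ℝ} (hσ : 0 < σ) (hε0 : 0 < ε) (hε : ε ≤ 144 * σ) (hδ : 0 < δ)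
    {d K M : ℕ} (hd : lam / 2 ^ d ≤ σ) (hK : 4 * d ≤ K) (hKδ : Real.log (2 / δ) ≤ K)
    (hM : 4 * (36 + 8 * 144 ^ 2) * (σ / ε) ≤ M)
    (hMδ : 64 * refineConst 144 * (σ ^ 2 / ε ^ 2 * Real.log (2312 / δ)) ≤ M) :
    (detEstimator _ (measurable_estimatorQuery (16 * σ) lam σ K M)
      (estimatorValue (16 * σ) lam σ K M) (2 * K + 2 * M)).IsPAC ε δ (subGaussianFamily lam σ) := by
  classical
  refine isPAC_detEstimator _ fun D hD => ?_
  obtain ⟨hm, hsub⟩ := hD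
  set m := ∫ y, y ∂(D : Measure ℝ) with hmdef
  set P := Measure.infinitePi fun _ : ℕ => (D : Measure ℝ)
  set κ := refineConst 144 with hκ
  have hκ0 : 0 < κ := refineConst_pos 144
  have hκ1 : 2048 ≤ κ := by
    have : 1 ≤ Real.exp (1 / 4 + (144 : ℝ) ^ 2 / 2) := Real.one_le_exp (by positivity)
    rw [hκ, refineConst]; linarith
  -- The error budget `ε` splits into four equal parts: a deviation and a bias for each sign.
  set η := ε / (4 * σ) with hη
  have hη0 : 0 ≤ η := by positivity
  have hη36 : η ≤ 36 := by rw [hη, div_le_iff₀ (by positivity)]; linarith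
  -- The possible coarse estimates after a successful search: `144 = 9 * 16`, hence at most `2 * 144
  -- + 1 = 289` values. Each gets failure probability `δ / 578`, for a total of `δ / 2`.
  set F := Finset.Icc ⌈m / σ - 144⌉ ⌊m / σ + 144⌋
  set far : Set (ℕ → ℝ) :=
    {x | (K : ℝ) ≤ 4 * ((Finset.range (2 * K)).filter fun i => 16 * σ < |x i - m|).card}
  set dev : ℤ → Set (ℕ → ℝ) := fun k => {x | σ * (2 * (η + (36 + 8 * 144 ^ 2) / (M + 1))) <
    |refinedEstimate σ (σ * k) (2 * K) M x - m|}
  have hmem : ∀ k : ℤ, k ∈ F ↔ |σ * k - m| ≤ 144 * σ := by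
    intro k
    rw [Finset.mem_Icc, Int.ceil_le, Int.le_floor, abs_le, sub_le_iff_le_add, div_le_iff₀ hσ,
      ← sub_le_iff_le_add, le_div_iff₀ hσ]
    constructor <;> rintro ⟨h1, h2⟩ <;> constructor <;> linarith
  have hfar : P.real far ≤ δ / 2 := by
    refine (measureReal_card_far_le hσ hsub (r := 16 * σ) le_rfl K).trans ?_
    rw [← Real.le_log_iff_exp_le (by positivity), neg_le, ← Real.log_inv, inv_div]
    have e : (16 * σ) ^ 2 / (32 * σ ^ 2) = 8 := by field_simp; norm_num
    rw [e]
    linarith [Nat.cast_nonneg (α := ℝ) K]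
  have hdev : ∀ k ∈ F, P.real (dev k) ≤ δ / 578 := by
    intro k hk
    refine (measureReal_lt_abs_refinedEstimate_sub_le hσ rfl hsub ((hmem k).1 hk) hη0
      (by linarith) (2 * K) M).trans ?_
    have h1 : Real.exp (-((M + 1) * (η ^ 2 / (4 * κ)))) ≤ δ / 2312 := by
      rw [← Real.le_log_iff_exp_le (by positivity), neg_le, ← Real.log_inv, inv_div]
      have e : η ^ 2 / (4 * κ) * (64 * κ * (σ ^ 2 / ε ^ 2 * Real.log (2312 / δ))) =
          Real.log (2312 / δ) := by rw [hη]; field_simp; norm_num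
      rw [← e, mul_comm ((M : ℝ) + 1)]
      gcongr
      linarith
    linarith
  refine ⟨far ∪ ⋃ k ∈ F, dev k, ?_, fun x hx => ?_⟩
  · have hcard : (F.card : ℝ) ≤ 289 :=
      (card_Icc_ceil_floor_le (m / σ) 144 (by norm_num)).trans (by norm_num)
    have h1 : P.real (⋃ k ∈ F, dev k) ≤ F.card * (δ / 578) :=
      (measureReal_biUnion_finset_le F dev).trans
        ((Finset.sum_le_card_nsmul _ _ _ hdev).trans_eq (nsmul_eq_mul _ _))
    have h2 : (F.card : ℝ) * (δ / 578) ≤ 289 * (δ / 578) := by gcongr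
    linarith [measureReal_union_le (μ := P) far (⋃ k ∈ F, dev k)]
  · simp only [Set.mem_union, Set.mem_iUnion, not_or, not_exists] at hx
    have hx' := not_le.1 (show ¬ (K : ℝ) ≤ _ from hx.1)
    have h := abs_pathDecode_searchState_sub_le (r := 16 * σ) (M := M) hσ (by linarith)
      (abs_le.2 hm) (hd.trans (by linarith)) hK (x := x) (by exact_mod_cast hx')
    have h2 := hx.2 _ ((hmem _).2 (h.trans_eq (by ring)))
    rw [estimatorValue_bits]
    refine (not_lt.1 h2).trans ?_
    have h3 : (36 + 8 * 144 ^ 2) / ((M : ℝ) + 1) ≤ η := by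
      rw [div_le_iff₀ (by positivity), hη]
      have e : ε / (4 * σ) * (4 * (36 + 8 * 144 ^ 2) * (σ / ε)) = 36 + 8 * 144 ^ 2 := by
        field_simp
      calc (36 + 8 * 144 ^ 2 : ℝ) = ε / (4 * σ) * (4 * (36 + 8 * 144 ^ 2) * (σ / ε)) := e.symm
        _ ≤ ε / (4 * σ) * (M + 1) := by gcongr; linarith
    have e : σ * (2 * (η + η)) = ε := by rw [hη]; field_simp; ring
    rw [← e]
    gcongr

/-! ### Counting samples in the regimes of `ε` -/

theorem exists_nat_div_two_pow_le {lam σ : ℝ} (hσ : 0 < σ) (hlam : σ ≤ lam) :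
    ∃ d : ℕ, lam / 2 ^ d ≤ σ ∧ (d : ℝ) ≤ 2 * Real.log (lam / σ) + 1 := by
  have h1 : 1 ≤ lam / σ := (one_le_div hσ).2 hlam
  have hlog2 : 1 / 2 < Real.log 2 := by linarith [Real.log_two_gt_d9]
  have hl : 0 ≤ Real.log (lam / σ) := Real.log_nonneg h1
  refine ⟨⌈Real.log (lam / σ) / Real.log 2⌉₊, ?_, ?_⟩
  · have h2 := Nat.le_ceil (Real.log (lam / σ) / Real.log 2)
    rw [div_le_iff₀ (by linarith), ← Real.log_pow, Real.log_le_log_iff (by linarith) (by positivity),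
      div_le_iff₀ hσ] at h2
    rw [div_le_iff₀ (by positivity)]
    linarith
  · have h2 := Nat.ceil_lt_add_one (a := Real.log (lam / σ) / Real.log 2)
      (div_nonneg hl (by linarith))
    have h3 : Real.log (lam / σ) / Real.log 2 ≤ 2 * Real.log (lam / σ) := by
      rw [div_le_iff₀ (by linarith)]
      nlinarith
    linarith

/-- The coarse regime uses few enough samples. -/
theorem exists_estimator_of_large_error {lam σ ε δ : ℝ} (hσ : 0 < σ) (hlam : σ ≤ lam)
    (hε : 144 * σ ≤ ε) (hεlam : ε < lam) (hδ : 0 < δ) (hδ1 : δ < 1) :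
    ∃ (n : ℕ) (A : OneBitMeanEstimator n), A.IsPAC ε δ (subGaussianFamily lam σ) ∧
      (n : ℝ) ≤ 6000 * (σ ^ 2 / ε ^ 2 * Real.log (1 / δ) + Real.log (lam / σ)) := by
  obtain ⟨d, hd, hdle⟩ := exists_nat_div_two_pow_le hσ hlam
  set T := σ ^ 2 / ε ^ 2 * Real.log (1 / δ) with hT
  have hT0 : 0 ≤ T :=
    mul_nonneg (by positivity) (Real.log_nonneg ((one_le_div hδ).2 hδ1.le))
  refine ⟨_, _, isPAC_search (K := 4 * d + ⌈2592 * T⌉₊) hσ hε hδ hd (by omega) ?_, ?_⟩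
  · push_cast
    linarith [Nat.le_ceil (2592 * T), Nat.cast_nonneg (α := ℝ) d]
  · have h1 := Nat.ceil_lt_add_one (a := 2592 * T) (by positivity)
    -- Here `lam / σ > 144 > e`, so the logarithm absorbs all rounding constants and `C` need not
    -- depend on `δ₀` in this regime.
    have h2 : 1 ≤ Real.log (lam / σ) := by
      rw [Real.le_log_iff_exp_le (by have := hσ.trans_le hlam; positivity), le_div_iff₀ hσ]
      nlinarith [Real.exp_one_lt_d9]
    push_cast
    linarith

/-- The fine regime uses few enough samples. -/
theorem exists_estimator_of_small_error {δ₀ : ℝ} (h0 : 0 < δ₀) (h1 : δ₀ < 1) :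
    ∃ C : ℝ, 0 < C ∧ ∀ lam σ ε δ : ℝ, 0 < σ → σ ≤ lam → 0 < ε → ε ≤ 144 * σ → 0 < δ → δ ≤ δ₀ →
      ∃ (n : ℕ) (A : OneBitMeanEstimator n), A.IsPAC ε δ (subGaussianFamily lam σ) ∧
        (n : ℝ) ≤ C * (σ ^ 2 / ε ^ 2 * Real.log (1 / δ) + Real.log (lam / σ)) := by
  set Λ := Real.log (1 / δ₀) with hΛ
  have hΛ0 : 0 < Λ := Real.log_pos ((one_lt_div h0).2 h1)
  obtain ⟨κ, hκ⟩ : ∃ κ, κ = refineConst 144 := ⟨_, rfl⟩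
  have hκ0 : 0 < κ := hκ ▸ refineConst_pos 144
  have hlog : ∀ b : ℝ, 1 ≤ b → ∀ δ, 0 < δ → δ ≤ δ₀ →
      Real.log (b / δ) ≤ (1 + Real.log b / Λ) * Real.log (1 / δ) := by
    intro b hb δ hδ hδ0
    have h2 : Λ ≤ Real.log (1 / δ) :=
      Real.log_le_log (by positivity) (one_div_le_one_div_of_le hδ hδ0)
    have h3 : Real.log b ≤ Real.log b / Λ * Real.log (1 / δ) := by
      rw [div_mul_eq_mul_div, le_div_iff₀ hΛ0]
      exact mul_le_mul_of_nonneg_left h2 (Real.log_nonneg hb)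
    rw [show b / δ = b * (1 / δ) by ring, Real.log_mul (by linarith) (by positivity)]
    linarith
  obtain ⟨B₁, hB₁⟩ : ∃ B₁, B₁ = 1 + Real.log 2 / Λ := ⟨_, rfl⟩
  obtain ⟨B₂, hB₂⟩ : ∃ B₂, B₂ = 1 + Real.log 2312 / Λ := ⟨_, rfl⟩
  obtain ⟨c, hc⟩ : ∃ c : ℝ, c = 4 * (36 + 8 * 144 ^ 2) * 144 := ⟨_, rfl⟩
  have hc0 : 0 < c := by rw [hc]; norm_num
  have hB₁0 : 0 ≤ B₁ := by
    have := Real.log_nonneg (x := 2) (by norm_num)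
    rw [hB₁]; positivity
  have hB₂0 : 0 ≤ B₂ := by
    have := Real.log_nonneg (x := 2312) (by norm_num)
    rw [hB₂]; positivity
  -- The `14` collects the additive constants: `8` from `8d` and `2` from each of three ceilings.
  -- Since `q u ≥ Λ / 144²`, they are absorbed into the main term; this is one place where `C`
  -- depends on `δ₀`.
  refine ⟨16 + 14 * (144 ^ 2 / Λ) + 2 * (B₁ * 144 ^ 2) + 2 * (64 * κ * B₂) + 2 * (c / Λ),
    by positivity, ?_⟩
  intro lam σ ε δ hσ hlam hε0 hε hδ hδ0
  obtain ⟨d, hd, hdle⟩ := exists_nat_div_two_pow_le hσ hlam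
  set q := σ ^ 2 / ε ^ 2 with hq
  set u := Real.log (1 / δ) with hu
  clear_value q
  -- The bias needs `M` of order `σ / ε`, which is dominated by `σ² / ε²` because `ε ≤ 144σ`.
  have hqu : σ / ε ≤ 144 * q := by
    have : q = σ / ε * (σ / ε) := by rw [hq]; ring
    have h2 : 1 ≤ 144 * (σ / ε) := by rw [← mul_div_assoc, le_div_iff₀ hε0]; linarith
    have h3 : 0 ≤ σ / ε := by positivity
    rw [this]
    nlinarith
  have hq1 : 1 ≤ 144 ^ 2 * q := by
    have : 144 ^ 2 * q = (144 * σ) ^ 2 / ε ^ 2 := by rw [hq]; ring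
    rw [this, le_div_iff₀ (by positivity), one_mul]
    gcongr
  have hq0 : 0 < q := by linarith
  have huΛ : Λ ≤ u := Real.log_le_log (by positivity) (one_div_le_one_div_of_le hδ hδ0)
  have hu0 : 0 < u := hΛ0.trans_le huΛ
  have hl : 0 ≤ Real.log (lam / σ) := Real.log_nonneg ((one_le_div hσ).2 hlam)
  have hl1 := hlog 2 (by norm_num) δ hδ hδ0
  rw [← hB₁] at hl1
  have hl2 := hlog 2312 (by norm_num) δ hδ hδ0
  rw [← hB₂] at hl2
  refine ⟨_, _, isPAC_refine (K := 4 * d + ⌈B₁ * u⌉₊)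
    (M := ⌈64 * κ * (q * (B₂ * u))⌉₊ + ⌈c * q⌉₊) hσ hε0 hε hδ hd (by omega) ?_ ?_ ?_, ?_⟩
  · push_cast
    linarith [Nat.le_ceil (B₁ * u), Nat.cast_nonneg (α := ℝ) d]
  · push_cast
    have h2 : 4 * (36 + 8 * 144 ^ 2) * (σ / ε) ≤ c * q := by
      rw [hc]
      linarith
    linarith [Nat.le_ceil (c * q), Nat.cast_nonneg (α := ℝ) ⌈64 * κ * (q * (B₂ * u))⌉₊]
  · rw [← hκ, ← hq]
    push_cast
    have h2 : 64 * κ * (q * Real.log (2312 / δ)) ≤ 64 * κ * (q * (B₂ * u)) := by gcongr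
    linarith [Nat.le_ceil (64 * κ * (q * (B₂ * u))), Nat.cast_nonneg (α := ℝ) ⌈c * q⌉₊]
  · have k1 := Nat.ceil_lt_add_one (a := B₁ * u) (by positivity)
    have k2 := Nat.ceil_lt_add_one (a := 64 * κ * (q * (B₂ * u))) (by positivity)
    have k3 := Nat.ceil_lt_add_one (a := c * q) (by positivity)
    have m1 : 1 ≤ 144 ^ 2 / Λ * (q * u) := by
      rw [div_mul_eq_mul_div, le_div_iff₀ hΛ0, one_mul]
      nlinarith
    have m2 : B₁ * u ≤ B₁ * 144 ^ 2 * (q * u) := by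
      have := mul_le_mul_of_nonneg_left hq1 (mul_nonneg hB₁0 hu0.le)
      linarith
    have m3 : c * q ≤ c / Λ * (q * u) := by
      rw [div_mul_eq_mul_div, le_div_iff₀ hΛ0]
      have := mul_le_mul_of_nonneg_left huΛ (show 0 ≤ c * q by positivity)
      linarith
    have m4 : 0 ≤ (14 * (144 ^ 2 / Λ) + 2 * (B₁ * 144 ^ 2) + 2 * (64 * κ * B₂) + 2 * (c / Λ)) *
      Real.log (lam / σ) := by positivity
    push_cast
    have m5 : 0 ≤ q * u := by positivity
    linarith

theorem mainTheorem4 :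
    ∀ δ₀ : ℝ, 0 < δ₀ → δ₀ < 1 →
      ∃ C : ℝ, 0 < C ∧
        ∀ lam σ ε δ : ℝ, 0 < σ → σ ≤ lam → 0 < ε → 0 < δ → δ ≤ δ₀ →
          ∃ (n : ℕ) (A : OneBitMeanEstimator n),
            A.IsPAC ε δ (subGaussianFamily lam σ) ∧
            (n : ℝ) ≤ C * (σ ^ 2 / ε ^ 2 * Real.log (1 / δ) + Real.log (lam / σ)) := by
  intro δ₀ h0 h1
  obtain ⟨C, hC, hsmall⟩ := exists_estimator_of_small_error h0 h1
  refine ⟨C + 6000, by linarith, fun lam σ ε δ hσ hlam hε hδ hδ0 => ?_⟩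
  have hR : 0 ≤ σ ^ 2 / ε ^ 2 * Real.log (1 / δ) + Real.log (lam / σ) :=
    add_nonneg (mul_nonneg (by positivity)
      (Real.log_nonneg ((one_le_div hδ).2 (hδ0.trans h1.le))))
      (Real.log_nonneg ((one_le_div hσ).2 hlam))
  rcases le_total ε (144 * σ) with h | h
  · obtain ⟨n, A, hA, hn⟩ := hsmall lam σ ε δ hσ hlam hε h hδ hδ0
    exact ⟨n, A, hA, by linarith⟩
  rcases lt_or_ge ε lam with h2 | h2
  · obtain ⟨n, A, hA, hn⟩ :=
      exists_estimator_of_large_error hσ hlam h h2 hδ (hδ0.trans_lt h1)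
    exact ⟨n, A, hA, by nlinarith⟩
  · refine ⟨0, detEstimator (fun _ _ => false) (fun _ => measurable_const) (fun _ => 0) 0,
      isPAC_detEstimator _ fun D hD => ⟨∅, by simpa using hδ.le, fun x _ => ?_⟩, ?_⟩
    · rw [zero_sub, abs_neg]
      exact (abs_le.2 hD.1).trans h2
    · push_cast
      positivity
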